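/- Fix a finite relational signature $L$. All $L$-structures have domain $\omega$; such a structure is computable if its atomic diagram is computable, and $\mathcal S\restriction_n$ denotes the restriction of $\mathcal S$ to $\{0,1,\dots,n\}$. Let $\mathfrak K=\{\mathcal A_0,\dots,\mathcal A_m\}$ be a finite family of pairwise non-isomorphic computable $L$-structures, and let $\mathrm{LD}(\mathfrak K)$ be the class of all $L$-structures with domain $\omega$ that are isomorphic to some member of $\mathfrak K$. A learner for $\mathfrak K$ is a function $M$ from $\{\mathcal S\restriction_n:\mathcal S\in\mathrm{LD}(\mathfrak K),\ n\in\omega\}$ to the set of hypotheses $\{\ulcorner\mathcal A_0\urcorner,\dots,\ulcorner\mathcal A_m\urcorner,?\}$. It learns $\mathfrak K$ if, for every $\mathcal S\in\mathrm{LD}(\mathfrak K)$ and every $i\le m$, $\lim_{n\to\infty}M(\mathcal S\restriction_n)=\ulcorner\mathcal A_i\urcorner$ if and only if $\mathcal S\cong\mathcal A_i$. The family $\mathfrak K$ is learnable if some learner learns it. A learner is computable if, with respect to a standard coding of finite $L$-structures by natural numbers, it is the restriction of a partial computable function that is defined on all of its domain. Theorem. There are a finite relational signature $L$ and a pair $\mathfrak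 K=\{\mathcal A_0,\mathcal A_1\}$ of non-isomorphic computable $L$-structures such that $\mathfrak K$ is learnable, but no computable learner learns $\mathfrak K$. -/

import Mathlib

namespace StructLearning

open Filter

/-- The finite relational signature with relation symbols `0, …, k - 1`, where the symbol `i`
has arity `ar i`, and with no function symbols (hence no constants). -/
def sig {k : ℕ} (ar : Fin k → ℕ) : FirstOrder.Language.{0, 0} where
  Functions := fun _ => Empty
  Relations := fun n => {i : Fin k // ar i = n}

/-- The `i`-th relation symbol of `sig ar`. -/
def sym {k : ℕ} (ar : Fin k → ℕ) (i : Fin k) : (sig ar).Relations (ar i) := ⟨i, rfl⟩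

/-- Structures for the signature `sig ar` whose domain is the set of all natural numbers. -/
abbrev Str {k : ℕ} (ar : Fin k → ℕ) : Type := (sig ar).Structure ℕ

/-- `S` and `T` are isomorphic, that is, copies of each other. -/
def Iso {k : ℕ} {ar : Fin k → ℕ} (S T : Str ar) : Prop :=
  Nonempty (@FirstOrder.Language.Equiv (sig ar) ℕ ℕ S T)

/-- `S` is a computable structure: since the signature is finite, its atomic diagram is computable
exactly if each of its basic relations is a computable relation on the natural numbers. -/
def IsComputable {k : ℕ} {ar : Fin k → ℕ} (S : Str ar) : Prop :=
  ∀ i : Fin k, ComputablePred fun v : Fin (ar i) → ℕ => S.RelMap (sym ar i) v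

/-- Finite structures for the signature `sig ar` with domain `{0, …, n}` for some `n`. -/
abbrev FinStr {k : ℕ} (ar : Fin k → ℕ) : Type := Σ n : ℕ, (sig ar).Structure (Fin (n + 1))

/-- The restriction of `S` to the domain `{0, …, n}`. -/
def restrict {k : ℕ} {ar : Fin k → ℕ} (S : Str ar) (n : ℕ) : FinStr ar :=
  ⟨n, { funMap := fun f _ => Empty.elim f
        RelMap := fun R v => S.RelMap R fun j => (v j : ℕ) }⟩

/-- All `m`-tuples over `{0, …, N - 1}`, in lexicographic order. -/
def tuples (N : ℕ) : (m : ℕ) → List (Fin m → Fin N)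
  | 0 => [Fin.elim0]
  | m + 1 => (List.finRange N).flatMap fun a => (tuples N m).map fun v => Fin.cons a v

open Classical in
/-- The code of a finite structure on `{0, …, n}`: the number `n` together with, for each relation
symbol, the truth table of its interpretation, tuples being listed in lexicographic order. -/
noncomputable def code {k : ℕ} {ar : Fin k → ℕ} (s : FinStr ar) : ℕ × List (List Bool) :=
  (s.1, List.ofFn fun i : Fin k =>
    (tuples (s.1 + 1) (ar i)).map fun v => decide (s.2.RelMap (sym ar i) v))

/-- The learning domain of a finite family `K`: all copies (with domain `ℕ`) of its members. -/
def learningDomain {k m : ℕ} {ar : Fin k → ℕ} (K : Fin m → Str ar) : Set (Str ar) :=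
  {S | ∃ i, Iso S (K i)}

/-- The hypothesis space of a family of `m` structures: `some i` is the conjecture
"this is `K i`", and `none` is the question mark. -/
abbrev Hypothesis (m : ℕ) : Type := Option (Fin m)

/-- The data that a learner may see: restrictions of members of the learning domain. -/
def data {k m : ℕ} {ar : Fin k → ℕ} (K : Fin m → Str ar) : Set (FinStr ar) :=
  {s | ∃ S ∈ learningDomain K, ∃ n, restrict S n = s}

/-- A learner for `K`: an arbitrary function from the data to the hypotheses. -/
abbrev Learner {k m : ℕ} {ar : Fin k → ℕ} (K : Fin m → Str ar) : Type :=
  data K → Hypothesis m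

/-- `M` learns `K`: for every `S` in the learning domain, the conjectures on the restrictions of
`S` stabilize to "this is `K i`" if and only if `S` is a copy of `K i`. -/
def Learner.Learns {k m : ℕ} {ar : Fin k → ℕ} {K : Fin m → Str ar} (M : Learner K) : Prop :=
  ∀ (S : Str ar) (hS : S ∈ learningDomain K) (i : Fin m),
    (∀ᶠ n in atTop, M ⟨restrict S n, S, hS, n, rfl⟩ = some i) ↔ Iso S (K i)

/-- `M` is a computable learner: some partial computable function on codes of finite structures is
defined and agrees with `M` on all the data (what it does elsewhere is irrelevant). -/
def Learner.IsComputable {k m : ℕ} {ar : Fin k → ℕ} {K : Fin m → Str ar} (M : Learner K) : Prop :=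
  ∃ φ : ℕ × List (List Bool) →. Hypothesis m, Partrec φ ∧ ∀ s : data K, M s ∈ φ (code s.1)

/-- The family `K` is learnable (in the limit, up to isomorphism). -/
def Learnable {k m : ℕ} {ar : Fin k → ℕ} (K : Fin m → Str ar) : Prop :=
  ∃ M : Learner K, M.Learns

/-- The family `K` is learnable by a computable learner. -/
def ComputablyLearnable {k m : ℕ} {ar : Fin k → ℕ} (K : Fin m → Str ar) : Prop :=
  ∃ M : Learner K, M.IsComputable ∧ M.Learns

end StructLearning

/-!
Points of the structures carry a label in `ℕ` and are grouped into classes. A chain of successors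
starting at label `0` makes labels visible to homomorphisms, and all multiplicities are infinite, so
the isomorphism type is determined by the collection of the label sets of the classes
(`iso_pullback`). A class can thus be any nonempty computably enumerable set, and a uniform
enumeration of the classes makes the structure computable.

Let `X` be `haltSet`, the c.e. set of all pairs `⟨e, k⟩` such that the program `e` halts on all
inputs up to `k`, and let `b ∉ X`. Both structures have the common classes `X ∪ {t}` for `t ∉ X`,
and the full class `ℕ`; this collection is uniformly c.e., because a class started as `X ∪ {t}` can
become full when `t` enters `X`. Besides these, the first structure has the class `X` and the second
one the class `{b}`.

The pair is learnable. No class of the second structure is a subset of `X`, and none of the first is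
a subset of `{b}`, so each wrong guess "this point lies in the class `X`" (or `{b}`) is refuted by
a finite part of the structure. The learner compares the least points for which such a guess has not
been refuted (`learnable_pair`). Recognizing a refutation means recognizing that a label is not in
`X`, which cannot be done effectively.

No computable learner succeeds. For each program `e` there is, uniformly in `e`, a computable
structure that is a copy of the first structure if `e` is total and of the second one if `e`
diverges somewhere (`iso_diag_of_total`, `iso_diag_of_not_total`). Given a computable learner, the
recursion theorem yields a program `e` that halts on `k` exactly if the learner, on the structure of
`e` itself, makes a conjecture other than the first structure at some stage from `k` on
(`not_computablyLearnable`). If `e` is total, the learner does not converge to the correct answer;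
otherwise it converges to the wrong one.
-/

namespace StructLearning

open Filter

/-! ### Structures made of labelled classes -/

/-- The template from which all structures are pulled back. A point `(i, n)` lies in the class `i`
and carries the label `n`. The three relations say that the first point has label `0`, that the
second label is the successor of the first one, and that the classes agree; the first of them is
made binary so that all symbols have the same arity. -/
def templateRel (j : Fin 3) (a b : ℕ × ℕ) : Bool :=
  if j = 0 then a.2 == 0 else if j = 1 then b.2 == a.2 + 1 else a.1 == b.1

/-- The structure on `ℕ` pulled back from the template along `f`. -/
abbrev pullback (f : ℕ → ℕ × ℕ) : Str (fun _ : Fin 3 => 2) where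
  funMap F _ := Empty.elim F
  RelMap R v := templateRel R.1 (f (v (Fin.cast R.2 0))) (f (v (Fin.cast R.2 1))) = true

/-- The set of labels that occur in the class `i`. -/
def labels (f : ℕ → ℕ × ℕ) (i : ℕ) : Set ℕ := {n | ∃ m, f m = (i, n)}

/-- Every point and every nonempty set of labels is repeated infinitely often, so that
multiplicities carry no information about the isomorphism type. -/
structure Repetitive (f : ℕ → ℕ × ℕ) : Prop where
  points : ∀ m, {m' | f m' = f m}.Infinite
  classes : ∀ i, (labels f i).Nonempty → {j | labels f j = labels f i}.Infinite

theorem exists_equiv_of_infinite_fibers {α β γ : Type*} [Countable α] [Countable β]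
    (u : α → γ) (v : β → γ) (hu : ∀ a, {a' | u a' = u a}.Infinite)
    (hv : ∀ b, {b' | v b' = v b}.Infinite) (huv : Set.range u = Set.range v) :
    ∃ e : α ≃ β, ∀ a, v (e a) = u a := by
  have key : ∀ c, Nonempty ({a // u a = c} ≃ {b // v b = c}) := by
    intro c
    by_cases hc : c ∈ Set.range u
    · obtain ⟨a, rfl⟩ := hc
      obtain ⟨b, hb⟩ : u a ∈ Set.range v := huv ▸ ⟨a, rfl⟩
      have h1 : Infinite {a' // u a' = u a} := (hu a).to_subtype
      have h2 : Infinite {b' // v b' = u a} := hb ▸ (hv b).to_subtype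
      obtain ⟨d1⟩ := nonempty_denumerable {a' // u a' = u a}
      obtain ⟨d2⟩ := nonempty_denumerable {b' // v b' = u a}
      exact ⟨Denumerable.equiv₂ _ _⟩
    · have h1 : IsEmpty {a // u a = c} := ⟨fun a => hc ⟨a.1, a.2⟩⟩
      have h2 : IsEmpty {b // v b = c} := ⟨fun b => hc (huv ▸ ⟨b.1, b.2⟩)⟩
      exact ⟨Equiv.equivOfIsEmpty _ _⟩
  exact ⟨Equiv.ofFiberEquiv fun c => (key c).some, fun a => Equiv.ofFiberEquiv_map _ a⟩

theorem labels_nonempty (f : ℕ → ℕ × ℕ) (m : ℕ) : (labels f (f m).1).Nonempty :=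
  ⟨(f m).2, m, rfl⟩

theorem exists_equiv_classes {f g : ℕ → ℕ × ℕ} (hf : Repetitive f) (hg : Repetitive g)
    (hfg : ∀ i, (labels f i).Nonempty → ∃ j, labels g j = labels f i)
    (hgf : ∀ i, (labels g i).Nonempty → ∃ j, labels f j = labels g i) :
    ∃ e : {i // (labels f i).Nonempty} ≃ {i // (labels g i).Nonempty},
      ∀ i, labels g (e i).1 = labels f i.1 := by
  have inf : ∀ {f : ℕ → ℕ × ℕ}, Repetitive f → ∀ a : {i // (labels f i).Nonempty},
      {a' : {i // (labels f i).Nonempty} | labels f a'.1 = labels f a.1}.Infinite := by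
    intro f hf a
    refine Set.Infinite.of_image (fun x => x.1) ((hf.classes a.1 a.2).mono ?_)
    intro j hj
    exact ⟨⟨j, by rw [Set.mem_ofPred_eq] at hj; rw [hj]; exact a.2⟩, hj, rfl⟩
  refine exists_equiv_of_infinite_fibers (fun i : {i // (labels f i).Nonempty} => labels f i.1)
    (fun i : {i // (labels g i).Nonempty} => labels g i.1) (inf hf) (inf hg) ?_
  ext A
  constructor
  · rintro ⟨i, rfl⟩
    obtain ⟨j, hj⟩ := hfg i.1 i.2
    exact ⟨⟨j, hj ▸ i.2⟩, hj⟩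
  · rintro ⟨i, rfl⟩
    obtain ⟨j, hj⟩ := hgf i.1 i.2
    exact ⟨⟨j, hj ▸ i.2⟩, hj⟩

/-- The isomorphism type of a repetitive structure is determined by its nonempty sets of labels. -/
theorem iso_pullback {f g : ℕ → ℕ × ℕ} (hf : Repetitive f) (hg : Repetitive g)
    (hfg : ∀ i, (labels f i).Nonempty → ∃ j, labels g j = labels f i)
    (hgf : ∀ i, (labels g i).Nonempty → ∃ j, labels f j = labels g i) :
    Iso (pullback f) (pullback g) := by
  obtain ⟨e, he⟩ := exists_equiv_classes hf hg hfg hgf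
  obtain ⟨σ, hσ⟩ := exists_equiv_of_infinite_fibers
    (fun m => (e ⟨(f m).1, labels_nonempty f m⟩, (f m).2))
    (fun m => ((⟨(g m).1, labels_nonempty g m⟩ : {i // (labels g i).Nonempty}), (g m).2))
    (fun m => (hf.points m).mono fun m' hm' => by
      rw [Set.mem_ofPred_eq] at hm'; simp only [Set.mem_ofPred_eq, hm'])
    (fun m => (hg.points m).mono fun m' hm' => by
      rw [Set.mem_ofPred_eq] at hm'; simp only [Set.mem_ofPred_eq, hm'])
    (by
      ext ⟨i, n⟩
      constructor
      · rintro ⟨m, hm⟩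
        simp only [Prod.mk.injEq] at hm
        obtain ⟨rfl, rfl⟩ := hm
        obtain ⟨m', hm'⟩ : (f m).2 ∈ labels g (e ⟨(f m).1, labels_nonempty f m⟩).1 := by
          rw [he]; exact ⟨m, rfl⟩
        exact ⟨m', by simp [hm']⟩
      · rintro ⟨m, hm⟩
        simp only [Prod.mk.injEq] at hm
        obtain ⟨rfl, rfl⟩ := hm
        obtain ⟨m', hm'⟩ : (g m).2 ∈ labels f (e.symm ⟨(g m).1, labels_nonempty g m⟩).1 := by
          rw [← he, Equiv.apply_symm_apply]; exact ⟨m, rfl⟩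
        exact ⟨m', by simp [hm']⟩)
  simp only [Prod.mk.injEq, Subtype.ext_iff] at hσ
  have h2 : ∀ m, (g (σ m)).2 = (f m).2 := fun m => (hσ m).2
  have h1 : ∀ m m', (g (σ m)).1 = (g (σ m')).1 ↔ (f m).1 = (f m').1 := by
    intro m m'
    rw [(hσ m).1, (hσ m').1, ← Subtype.ext_iff, e.apply_eq_iff_eq, Subtype.mk.injEq]
  refine ⟨@FirstOrder.Language.Equiv.mk _ _ _ (pullback f) (pullback g) σ
    (fun F => Empty.elim F) ?_⟩
  intro n R v
  change templateRel R.1 (g (σ _)) (g (σ _)) = true ↔ templateRel R.1 (f _) (f _) = true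
  simp only [templateRel, h2]
  split_ifs <;> simp [h1]

/-! ### Learning by comparing embeddings -/

/-- The finite structure `s` is compatible with a copy of `pullback f` in which the point `p` lies
in the class `i`. Only homomorphisms are asked for: a chain of successors starting at label `0`
fixes the labels of its members. -/
def Compatible (f : ℕ → ℕ × ℕ) (i : ℕ) (s : FinStr (fun _ : Fin 3 => 2)) (p : ℕ) : Prop :=
  ∃ u : Fin (s.1 + 1) → ℕ,
    (∀ j (v : Fin 2 → Fin (s.1 + 1)), s.2.RelMap (sym (fun _ : Fin 3 => 2) j) v →
      templateRel j (f (u (v 0))) (f (u (v 1))) = true) ∧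
    ∃ x, x.1 = p ∧ (f (u x)).1 = i

theorem exists_equiv_of_iso_pullback {S : Str (fun _ : Fin 3 => 2)} {f : ℕ → ℕ × ℕ} :
    Iso S (pullback f) → ∃ h : ℕ ≃ ℕ, ∀ j (v : Fin 2 → ℕ),
      S.RelMap (sym (fun _ : Fin 3 => 2) j) v ↔
        templateRel j (f (h (v 0))) (f (h (v 1))) = true := by
  rintro ⟨h⟩
  exact ⟨@FirstOrder.Language.Equiv.toEquiv _ _ _ S (pullback f) h, fun j v =>
    (@FirstOrder.Language.Equiv.map_rel' _ _ _ S (pullback f) h _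
      (sym (fun _ : Fin 3 => 2) j) v).symm⟩

theorem compatible_of_iso {S : Str (fun _ : Fin 3 => 2)} {f : ℕ → ℕ × ℕ} {h : ℕ ≃ ℕ}
    (hh : ∀ j (v : Fin 2 → ℕ), S.RelMap (sym (fun _ : Fin 3 => 2) j) v ↔
        templateRel j (f (h (v 0))) (f (h (v 1))) = true)
    {p N : ℕ} (hp : p ≤ N) : Compatible f (f (h p)).1 (restrict S N) p :=
  ⟨fun x => h x.1, fun j _ hv => (hh j _).1 hv, ⟨p, Nat.lt_succ_of_le hp⟩, rfl, rfl⟩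

/-- If some label `n` of the class of `p` is missing in the class `i` of `pullback g`, then every
sufficiently large finite part of `S` refutes that `p` lies in that class: it contains a point with
label `n` in the class of `p`, together with the chain of labels below it. -/
theorem eventually_not_compatible {S : Str (fun _ : Fin 3 => 2)} {f g : ℕ → ℕ × ℕ} {h : ℕ ≃ ℕ}
    (hh : ∀ j (v : Fin 2 → ℕ), S.RelMap (sym (fun _ : Fin 3 => 2) j) v ↔
        templateRel j (f (h (v 0))) (f (h (v 1))) = true)
    (hlab : ∀ n, ∃ m, (f m).2 = n) {p i : ℕ}
    (hp : ¬ labels f (f (h p)).1 ⊆ labels g i) :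
    ∀ᶠ N in atTop, ¬ Compatible g i (restrict S N) p := by
  obtain ⟨n, ⟨z, hz⟩, hn⟩ := Set.not_subset.1 hp
  choose c hc using hlab
  -- A chain of points with labels `0, …, n` that ends in the class of `p`.
  have hc' : ∀ j, (f (Function.update c n z j)).2 = j := by
    intro j
    rcases eq_or_ne j n with rfl | hj
    · simp [hz]
    · rw [Function.update_of_ne hj, hc]
  set d : ℕ → ℕ := fun j => h.symm (Function.update c n z j) with hd
  have hd2 : ∀ j, (f (h (d j))).2 = j := by simpa [hd] using hc'
  have hdn : f (h (d n)) = ((f (h p)).1, n) := by simp [hd, hz]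
  filter_upwards [eventually_ge_atTop p, eventually_ge_atTop ((Finset.range (n + 1)).sup d)]
    with N hN1 hN2
  rintro ⟨u, hu, x, hx, hxi⟩
  change Fin (N + 1) → ℕ at u
  change Fin (N + 1) at x
  have hdN : ∀ j, j ≤ n → d j < N + 1 := fun j hj =>
    Nat.lt_succ_of_le ((Finset.le_sup (Finset.mem_range.2 (Nat.lt_succ_of_le hj))).trans hN2)
  have rel : ∀ (j : Fin 3) (a b : Fin (N + 1)), templateRel j (f (h a)) (f (h b)) = true →
      templateRel j (g (u a)) (g (u b)) = true := by
    intro j a b hab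
    refine hu j ![a, b] ((hh j _).2 ?_)
    simpa using hab
  have hlabel : ∀ j (hj : j ≤ n), (g (u ⟨d j, hdN j hj⟩)).2 = j := by
    intro j
    induction j with
    | zero =>
      intro hj
      have := rel 0 ⟨d 0, hdN 0 hj⟩ ⟨d 0, hdN 0 hj⟩ (by simp [templateRel, hd2])
      simpa [templateRel] using this
    | succ j ih =>
      intro hj
      have := rel 1 ⟨d j, hdN j (by lia)⟩ ⟨d (j + 1), hdN _ hj⟩ (by simp [templateRel, hd2])
      simpa [templateRel, ih (by lia)] using this
  have hcls := rel 2 x ⟨d n, hdN n le_rfl⟩ (by simp [templateRel, hdn, hx])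
  simp only [templateRel] at hcls
  refine hn ⟨u ⟨d n, hdN n le_rfl⟩, Prod.ext ?_ (hlabel n le_rfl)⟩
  rw [← hxi]
  exact (by simpa using hcls : (g (u x)).1 = _).symm

open Classical in
/-- If each of two structures has a class whose labels include those of no class of the other
structure, then the pair is learnable: the learner compares the least points that still look as if
they belonged to these two classes. -/
theorem learnable_pair {f g : ℕ → ℕ × ℕ} {i j : ℕ}
    (hfl : ∀ n, ∃ m, (f m).2 = n) (hgl : ∀ n, ∃ m, (g m).2 = n)
    (hi : (labels f i).Nonempty) (hj : (labels g j).Nonempty)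
    (hfj : ∀ m, ¬ labels f (f m).1 ⊆ labels g j) (hgi : ∀ m, ¬ labels g (g m).1 ⊆ labels f i) :
    Learnable ![pullback f, pullback g] ∧ ¬ Iso (pullback f) (pullback g) := by
  set M : FinStr (fun _ : Fin 3 => 2) → Hypothesis 2 := fun s =>
    if ∃ p, Compatible f i s p ∧ ∀ q ≤ p, ¬ Compatible g j s q then some 0 else some 1 with hM
  have h0 : ∀ S, Iso S (pullback f) → ∀ᶠ N in atTop, M (restrict S N) = some 0 := by
    intro S hS
    obtain ⟨h, hh⟩ := exists_equiv_of_iso_pullback hS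
    obtain ⟨_, m, hm⟩ := hi
    have hall : ∀ᶠ N in atTop, ∀ q ∈ Set.Iic (h.symm m), ¬ Compatible g j (restrict S N) q :=
      (Filter.eventually_all_finite (Set.finite_Iic _)).2 fun q _ =>
        eventually_not_compatible hh hfl (hfj _)
    filter_upwards [hall, eventually_ge_atTop (h.symm m)] with N hN1 hN2
    refine if_pos ⟨h.symm m, ?_, hN1⟩
    simpa [hm] using compatible_of_iso hh hN2
  have h1 : ∀ S, Iso S (pullback g) → ∀ᶠ N in atTop, M (restrict S N) = some 1 := by
    intro S hS
    obtain ⟨h, hh⟩ := exists_equiv_of_iso_pullback hS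
    obtain ⟨_, m, hm⟩ := hj
    have hall : ∀ᶠ N in atTop, ∀ q ∈ Set.Iic (h.symm m), ¬ Compatible f i (restrict S N) q :=
      (Filter.eventually_all_finite (Set.finite_Iic _)).2 fun q _ =>
        eventually_not_compatible hh hgl (hgi _)
    filter_upwards [hall, eventually_ge_atTop (h.symm m)] with N hN1 hN2
    refine if_neg ?_
    rintro ⟨p, hp1, hp2⟩
    rcases le_total p (h.symm m) with hpm | hpm
    · exact hN1 p hpm hp1
    · exact hp2 _ hpm (by simpa [hm] using compatible_of_iso hh hN2)
  have hboth : ∀ S, Iso S (pullback f) → Iso S (pullback g) → False := by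
    intro S hf hg
    obtain ⟨N, hN0, hN1⟩ := ((h0 S hf).and (h1 S hg)).exists
    rw [hN0] at hN1
    simp at hN1
  refine ⟨⟨fun s => M s.1, ?_⟩, fun h =>
    hboth _ ⟨@FirstOrder.Language.Equiv.refl _ _ (pullback f)⟩ h⟩
  intro S hS k
  change (∀ᶠ N in atTop, M (restrict S N) = some k) ↔ _
  constructor
  · intro hk
    obtain ⟨l, hl⟩ := hS
    have hl' : ∀ᶠ N in atTop, M (restrict S N) = some l := by
      fin_cases l
      · exact h0 S hl
      · exact h1 S hl
    obtain ⟨N, hN0, hN1⟩ := (hk.and hl').exists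
    rw [hN0, Option.some.injEq] at hN1
    exact hN1 ▸ hl
  · intro hk
    fin_cases k
    · exact h0 S hk
    · exact h1 S hk

/-! ### A computably enumerable set of halting segments -/

open Nat.Partrec (Code)

/-- The pair coded by `a` consists of a program and a bound; within `s` steps the program halts on
all inputs up to that bound. -/
def haltsBy (s a : ℕ) : Bool :=
  decide (∀ j < a.unpair.2 + 1,
    (Code.evaln s (Denumerable.ofNat Code a.unpair.1) j).isSome = true)

/-- The computably enumerable set of all pairs of a program and a bound such that the program halts
on all inputs up to that bound. -/
def haltSet : Set ℕ := {a | ∃ s, haltsBy s a = true}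

theorem haltsBy_mono {s s' a : ℕ} (h : s ≤ s') (ha : haltsBy s a = true) :
    haltsBy s' a = true := by
  simp only [haltsBy, decide_eq_true_eq, Option.isSome_iff_exists] at ha ⊢
  exact fun j hj => (ha j hj).imp fun _ hx => Code.evaln_mono h hx

theorem mem_haltSet {c : Code} {k : ℕ} :
    Nat.pair (Encodable.encode c) k ∈ haltSet ↔ ∀ j ≤ k, (c.eval j).Dom := by
  have key : ∀ s, haltsBy s (Nat.pair (Encodable.encode c) k) = true ↔
      ∀ j ≤ k, ∃ x, x ∈ Code.evaln s c j := by
    intro s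
    simp [haltsBy, Option.isSome_iff_exists]
  simp only [haltSet, Set.mem_ofPred_eq, key]
  constructor
  · rintro ⟨s, hs⟩ j hj
    obtain ⟨x, hx⟩ := hs j hj
    exact Part.dom_iff_mem.2 ⟨x, Code.evaln_sound hx⟩
  · intro h
    have : ∀ j, ∃ s, j ≤ k → ∃ x, x ∈ Code.evaln s c j := by
      intro j
      by_cases hj : j ≤ k
      · obtain ⟨x, hx⟩ := Part.dom_iff_mem.1 (h j hj)
        obtain ⟨s, hs⟩ := Code.evaln_complete.1 hx
        exact ⟨s, fun _ => ⟨x, hs⟩⟩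
      · exact ⟨0, fun h => absurd h hj⟩
    choose s hs using this
    refine ⟨(Finset.range (k + 1)).sup s, fun j hj => ?_⟩
    obtain ⟨x, hx⟩ := hs j hj
    exact ⟨x, Code.evaln_mono (Finset.le_sup (Finset.mem_range.2 (Nat.lt_succ_of_le hj))) hx⟩

theorem haltSet_nonempty : haltSet.Nonempty :=
  ⟨_, (mem_haltSet (c := Code.zero) (k := 0)).2 fun _ _ => trivial⟩

theorem exists_notMem_haltSet : ∃ b, b ∉ haltSet := by
  obtain ⟨c, hc⟩ := Code.exists_code.1 Nat.Partrec.none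
  refine ⟨Nat.pair (Encodable.encode c) 0, fun h => ?_⟩
  have := mem_haltSet.1 h 0 le_rfl
  rw [hc] at this
  exact this

/-! ### Families of computably enumerable classes -/

/-- The stage-wise enumeration of the classes of a family. The class `⟨0, t, _⟩` receives `t` and
`haltSet`, and becomes full once `t` enters `haltSet`; the class `⟨q + 1, t, _⟩` is enumerated by
`ex`, the special part of the family. Further components of an index only produce copies. -/
def stage (ex : ℕ → ℕ → ℕ → Bool) (s i n : ℕ) : Bool :=
  bif i.unpair.1 == 0 then
    n == i.unpair.2.unpair.1 || (haltsBy s n || haltsBy s i.unpair.2.unpair.1)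
  else ex s i.unpair.2.unpair.1 n

/-- The enumeration of all pairs (class, label) of the family with special part `ex`. The input
codes a stage, a class and a label; if the label has not yet been enumerated into the class, the
output is `(0, 0)`, which belongs to every family. -/
def family (ex : ℕ → ℕ → ℕ → Bool) (m : ℕ) : ℕ × ℕ :=
  bif stage ex m.unpair.1 m.unpair.2.unpair.1 m.unpair.2.unpair.2 then m.unpair.2.unpair
  else (0, 0)

/-- `haltSet ∪ {t}`, or all of `ℕ` if `t` already belongs to `haltSet`. -/
def commonClass (t : ℕ) : Set ℕ := {n | n = t ∨ n ∈ haltSet ∨ t ∈ haltSet}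

/-- The set that the special part `ex` enumerates into the class with parameter `t`. -/
def specialClass (ex : ℕ → ℕ → ℕ → Bool) (t : ℕ) : Set ℕ := {n | ∃ s, ex s t n = true}

/-- Once enumerated, a label stays enumerated. -/
def MonoStages (ex : ℕ → ℕ → ℕ → Bool) : Prop :=
  ∀ ⦃s s' t n⦄, s ≤ s' → ex s t n = true → ex s' t n = true

theorem stage_mono {ex : ℕ → ℕ → ℕ → Bool} (hex : MonoStages ex) : MonoStages (stage ex) := by
  intro s s' i n h hs
  unfold stage at hs ⊢
  cases hq : i.unpair.1 == 0 with
  | false => rw [hq] at hs; exact hex h hs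
  | true =>
    rw [hq] at hs
    simp only [cond_true, Bool.or_eq_true] at hs ⊢
    exact hs.imp_right (Or.imp (haltsBy_mono h) (haltsBy_mono h))

theorem labels_family_eq (ex : ℕ → ℕ → ℕ → Bool) (i : ℕ) :
    labels (family ex) i = specialClass (stage ex) i := by
  have h00 : stage ex 0 0 0 = true := by simp [stage]
  ext n
  constructor
  · rintro ⟨m, hm⟩
    unfold family at hm
    cases hs : stage ex m.unpair.1 m.unpair.2.unpair.1 m.unpair.2.unpair.2 with
    | true =>
      rw [hs] at hm
      simp only [cond_true, Prod.ext_iff] at hm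
      exact ⟨_, by rw [← hm.1, ← hm.2]; exact hs⟩
    | false =>
      rw [hs] at hm
      simp only [cond_false, Prod.mk.injEq] at hm
      exact ⟨0, by rw [← hm.1, ← hm.2]; exact h00⟩
  · rintro ⟨s, hs⟩
    exact ⟨Nat.pair s (Nat.pair i n), by simp [family, hs]⟩

theorem labels_family_common (ex : ℕ → ℕ → ℕ → Bool) {i : ℕ} (hi : i.unpair.1 = 0) :
    labels (family ex) i = commonClass i.unpair.2.unpair.1 := by
  rw [labels_family_eq]
  ext n
  simp only [specialClass, stage, hi, commonClass, haltSet, Set.mem_ofPred_eq, beq_self_eq_true,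
    cond_true, Bool.or_eq_true, beq_iff_eq, exists_or, exists_const]

theorem labels_family_special (ex : ℕ → ℕ → ℕ → Bool) {i : ℕ} (hi : i.unpair.1 ≠ 0) :
    labels (family ex) i = specialClass ex i.unpair.2.unpair.1 := by
  rw [labels_family_eq]
  simp [specialClass, stage, beq_eq_false_iff_ne.2 hi]

theorem labels_family_pair_zero (ex : ℕ → ℕ → ℕ → Bool) (t c : ℕ) :
    labels (family ex) (Nat.pair 0 (Nat.pair t c)) = commonClass t := by
  rw [labels_family_common ex (by simp)]; simp

theorem labels_family_pair_one (ex : ℕ → ℕ → ℕ → Bool) (t c : ℕ) :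
    labels (family ex) (Nat.pair 1 (Nat.pair t c)) = specialClass ex t := by
  rw [labels_family_special ex (by simp)]; simp

theorem labels_family_cases (ex : ℕ → ℕ → ℕ → Bool) (i : ℕ) :
    (∃ t, labels (family ex) i = commonClass t) ∨ ∃ t, labels (family ex) i = specialClass ex t :=
  (eq_or_ne i.unpair.1 0).imp (fun h => ⟨_, labels_family_common ex h⟩)
    fun h => ⟨_, labels_family_special ex h⟩

theorem exists_family_label (ex : ℕ → ℕ → ℕ → Bool) (n : ℕ) : ∃ m, (family ex m).2 = n := by
  obtain ⟨m, hm⟩ : n ∈ labels (family ex) (Nat.pair 0 (Nat.pair n 0)) := by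
    rw [labels_family_pair_zero]; exact Or.inl rfl
  exact ⟨m, by rw [hm]⟩

theorem repetitive_family {ex : ℕ → ℕ → ℕ → Bool} (hex : MonoStages ex) :
    Repetitive (family ex) where
  points m := by
    obtain ⟨s, hs⟩ : (family ex m).2 ∈ specialClass (stage ex) (family ex m).1 := by
      rw [← labels_family_eq]; exact ⟨m, rfl⟩
    refine Set.infinite_of_injective_forall_mem
      (f := fun r => Nat.pair (s + r) (Nat.pair (family ex m).1 (family ex m).2)) ?_ ?_
    · intro r r' h
      simpa using (Nat.pair_eq_pair.1 h).1
    · intro r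
      have := stage_mono hex (Nat.le_add_right s r) hs
      simp [family.eq_def ex (Nat.pair _ _), this]
  classes i _ := by
    refine Set.infinite_of_injective_forall_mem
      (f := fun r => Nat.pair i.unpair.1 (Nat.pair i.unpair.2.unpair.1 r)) ?_ ?_
    · intro r r' h
      exact (Nat.pair_eq_pair.1 (Nat.pair_eq_pair.1 h).2).2
    · intro r
      simp only [labels_family_eq, Set.mem_ofPred_eq, specialClass, stage, Nat.unpair_pair]

theorem exists_labels_family_eq {ex ex' : ℕ → ℕ → ℕ → Bool}
    (h : ∀ t, (specialClass ex t).Nonempty →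
      (∃ t', commonClass t' = specialClass ex t) ∨ ∃ t', specialClass ex' t' = specialClass ex t)
    (i : ℕ) (hi : (labels (family ex) i).Nonempty) :
    ∃ j, labels (family ex') j = labels (family ex) i := by
  rcases labels_family_cases ex i with ⟨t, ht⟩ | ⟨t, ht⟩
  · exact ⟨_, by rw [ht, labels_family_pair_zero ex' t 0]⟩
  · rw [ht] at hi ⊢
    rcases h t hi with ⟨t', h'⟩ | ⟨t', h'⟩
    · exact ⟨_, by rw [← h', labels_family_pair_zero ex' t' 0]⟩
    · exact ⟨_, by rw [← h', labels_family_pair_one ex' t' 0]⟩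

/-- Two families are isomorphic if each nonempty special class of either one is a common class or
a special class of the other one. -/
theorem iso_family {ex ex' : ℕ → ℕ → ℕ → Bool} (hex : MonoStages ex) (hex' : MonoStages ex')
    (h : ∀ t, (specialClass ex t).Nonempty →
      (∃ t', commonClass t' = specialClass ex t) ∨ ∃ t', specialClass ex' t' = specialClass ex t)
    (h' : ∀ t, (specialClass ex' t).Nonempty →
      (∃ t', commonClass t' = specialClass ex' t) ∨ ∃ t', specialClass ex t' = specialClass ex' t) :
    Iso (pullback (family ex)) (pullback (family ex')) :=
  iso_pullback (repetitive_family hex) (repetitive_family hex') (exists_labels_family_eq h)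
    (exists_labels_family_eq h')

/-! ### The pair of structures and the diagonal structures -/

/-- Special part of the first structure: all special classes are `haltSet`. -/
def haltStages (s _t n : ℕ) : Bool := haltsBy s n

/-- Special part of the second structure: all special classes are `{b}`. -/
def singletonStages (b _s _t n : ℕ) : Bool := n == b

/-- Within `s` steps the program `e` halts on all inputs below `k`. -/
def haltsBelowBy (s e k : ℕ) : Bool := k == 0 || haltsBy s (Nat.pair e (k - 1))

/-- Special part of the diagonal structure of the program `e`. The special class `0` receives
`haltSet` and `⟨e, k⟩` for all `k` such that `e` halts below `k`; it is `haltSet` if `e` is total,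
and otherwise `haltSet ∪ {⟨e, k⟩}` where `k` is the least input on which `e` diverges. The special
class `k + 1` receives `b` if `e` halts below `k`, and becomes full if `e` also halts on `k`; so it
is `{b}` exactly for the least `k` on which `e` diverges. -/
def diagStages (b e s t n : ℕ) : Bool :=
  bif t == 0 then haltsBy s n || (n.unpair.1 == e && haltsBelowBy s e n.unpair.2)
  else haltsBelowBy s e (t - 1) && (n == b || haltsBy s (Nat.pair e (t - 1)))

theorem haltStages_mono : MonoStages haltStages := fun _ _ _ _ h => haltsBy_mono h

theorem singletonStages_mono (b : ℕ) : MonoStages (singletonStages b) := fun _ _ _ _ _ h => h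

theorem haltsBelowBy_mono {s s' e k : ℕ} (h : s ≤ s') (hk : haltsBelowBy s e k = true) :
    haltsBelowBy s' e k = true := by
  simp only [haltsBelowBy, Bool.or_eq_true] at hk ⊢
  exact hk.imp_right (haltsBy_mono h)

theorem diagStages_mono (b e : ℕ) : MonoStages (diagStages b e) := by
  intro s s' t n h hs
  unfold diagStages at hs ⊢
  cases hq : t == 0 with
  | true =>
    rw [hq] at hs
    simp only [cond_true, Bool.or_eq_true, Bool.and_eq_true] at hs ⊢
    exact hs.imp (haltsBy_mono h) (And.imp_right (haltsBelowBy_mono h))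
  | false =>
    rw [hq] at hs
    simp only [cond_false, Bool.or_eq_true, Bool.and_eq_true] at hs ⊢
    exact hs.imp (haltsBelowBy_mono h) (Or.imp_right (haltsBy_mono h))

theorem specialClass_haltStages (t : ℕ) : specialClass haltStages t = haltSet := rfl

theorem specialClass_singletonStages (b t : ℕ) : specialClass (singletonStages b) t = {b} := by
  ext n; simp [specialClass, singletonStages]

/-- The program `e` halts on all inputs below `k`. -/
def HaltsBelow (e k : ℕ) : Prop := k = 0 ∨ Nat.pair e (k - 1) ∈ haltSet

theorem exists_haltsBelowBy {e k : ℕ} : (∃ s, haltsBelowBy s e k = true) ↔ HaltsBelow e k := by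
  simp [haltsBelowBy, HaltsBelow, haltSet, exists_or]

theorem specialClass_diagStages_zero (b e : ℕ) :
    specialClass (diagStages b e) 0 =
      {n | n ∈ haltSet ∨ n.unpair.1 = e ∧ HaltsBelow e n.unpair.2} := by
  ext n
  simp only [specialClass, diagStages, beq_self_eq_true, cond_true, Bool.or_eq_true,
    Bool.and_eq_true, beq_iff_eq, Set.mem_ofPred_eq, exists_or, exists_and_left,
    exists_haltsBelowBy]
  rfl

theorem specialClass_diagStages_succ (b e k : ℕ) :
    specialClass (diagStages b e) (k + 1) =
      {n | HaltsBelow e k ∧ (n = b ∨ Nat.pair e k ∈ haltSet)} := by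
  ext n
  simp only [specialClass, diagStages, Nat.add_sub_cancel,
    beq_eq_false_iff_ne.2 (Nat.succ_ne_zero k), cond_false, Bool.and_eq_true,
    Bool.or_eq_true, beq_iff_eq, Set.mem_ofPred_eq]
  constructor
  · rintro ⟨s, h1, h2⟩
    exact ⟨exists_haltsBelowBy.1 ⟨s, h1⟩, h2.imp_right fun h => ⟨s, h⟩⟩
  · rintro ⟨h1, h2⟩
    obtain ⟨s, hs⟩ := exists_haltsBelowBy.2 h1
    rcases h2 with h2 | ⟨s', hs'⟩
    · exact ⟨s, hs, Or.inl h2⟩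
    · exact ⟨max s s', haltsBelowBy_mono (le_max_left _ _) hs,
        Or.inr (haltsBy_mono (le_max_right _ _) hs')⟩

theorem commonClass_eq_univ {t : ℕ} (ht : t ∈ haltSet) : commonClass t = Set.univ :=
  Set.eq_univ_of_forall fun _ => Or.inr (Or.inr ht)

theorem specialClass_diagStages_of_mem {b e k : ℕ} (h : HaltsBelow e k)
    (hk : Nat.pair e k ∈ haltSet) : specialClass (diagStages b e) (k + 1) = Set.univ := by
  rw [specialClass_diagStages_succ]
  exact Set.eq_univ_of_forall fun _ => ⟨h, Or.inr hk⟩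

theorem iso_diag_of_total {b e : ℕ} (h : ∀ k, Nat.pair e k ∈ haltSet) :
    Iso (pullback (family (diagStages b e))) (pullback (family haltStages)) := by
  have h0 : specialClass (diagStages b e) 0 = haltSet := by
    rw [specialClass_diagStages_zero]
    refine Set.Subset.antisymm ?_ fun n hn => Or.inl hn
    rintro n (hn | ⟨rfl, -⟩)
    · exact hn
    · simpa using h n.unpair.2
  refine iso_family (diagStages_mono b e) haltStages_mono (fun t _ => ?_)
    fun t _ => Or.inr ⟨0, by rw [h0, specialClass_haltStages]⟩
  cases t with
  | zero => exact Or.inr ⟨0, by rw [h0, specialClass_haltStages]⟩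
  | succ k =>
    refine Or.inl ⟨Nat.pair e 0, ?_⟩
    rw [specialClass_diagStages_of_mem (Or.inr (h _)) (h k), commonClass_eq_univ (h 0)]

theorem iso_diag_of_not_total {b e k : ℕ}
    (hdown : ∀ i j, i ≤ j → Nat.pair e j ∈ haltSet → Nat.pair e i ∈ haltSet)
    (hk : Nat.pair e k ∉ haltSet) (hmin : ∀ j < k, Nat.pair e j ∈ haltSet) :
    Iso (pullback (family (diagStages b e))) (pullback (family (singletonStages b))) := by
  have hbelow : ∀ j, HaltsBelow e j ↔ j ≤ k := by
    intro j
    constructor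
    · rintro (rfl | hj)
      · exact Nat.zero_le _
      · by_contra hjk
        exact hk (hdown _ _ (by lia) hj)
    · intro hj
      rcases Nat.eq_zero_or_pos j with rfl | hj0
      · exact Or.inl rfl
      · exact Or.inr (hmin _ (by lia))
  have h0 : specialClass (diagStages b e) 0 = commonClass (Nat.pair e k) := by
    rw [specialClass_diagStages_zero]
    ext n
    simp only [commonClass, Set.mem_ofPred_eq, hk, or_false, hbelow]
    constructor
    · rintro (hn | ⟨rfl, hn⟩)
      · exact Or.inr hn
      · rcases hn.lt_or_eq with hn | hn
        · exact Or.inr (by simpa using hmin _ hn)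
        · exact Or.inl (by rw [← hn, Nat.pair_unpair])
    · rintro (rfl | hn)
      · exact Or.inr (by simp)
      · exact Or.inl hn
  have hsk : specialClass (diagStages b e) (k + 1) = {b} := by
    rw [specialClass_diagStages_succ]
    ext n
    simp [hk, hbelow]
  refine iso_family (diagStages_mono b e) (singletonStages_mono b) (fun t ht => ?_)
    fun t _ => Or.inr ⟨k + 1, by rw [hsk, specialClass_singletonStages]⟩
  cases t with
  | zero => exact Or.inl ⟨_, h0.symm⟩
  | succ j =>
    have hj : j ≤ k := by
      rw [specialClass_diagStages_succ] at ht
      obtain ⟨n, hn, -⟩ := ht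
      exact (hbelow j).1 hn
    rcases hj.lt_or_eq with hj' | rfl
    · refine Or.inl ⟨Nat.pair e j, ?_⟩
      rw [specialClass_diagStages_of_mem ((hbelow j).2 hj) (hmin j hj'),
        commonClass_eq_univ (hmin j hj')]
    · exact Or.inr ⟨0, by rw [hsk, specialClass_singletonStages]⟩

theorem learnable_halt_singleton {b : ℕ} (hb : b ∉ haltSet) :
    Learnable ![pullback (family haltStages), pullback (family (singletonStages b))] ∧
      ¬ Iso (pullback (family haltStages)) (pullback (family (singletonStages b))) := by
  have hsub : ∀ {A : Set ℕ}, haltSet ⊆ A → ¬ A ⊆ {b} := by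
    intro A hA hAb
    obtain ⟨a, ha⟩ := haltSet_nonempty
    exact hb (hAb (hA ha) ▸ ha)
  have hcommon : ∀ t, ¬ commonClass t ⊆ haltSet := by
    intro t ht
    have htm : t ∈ haltSet := ht (Or.inl rfl)
    exact hb (ht (commonClass_eq_univ htm ▸ Set.mem_univ b))
  refine learnable_pair (i := Nat.pair 1 (Nat.pair 0 0)) (j := Nat.pair 1 (Nat.pair 0 0))
    (exists_family_label _) (exists_family_label _) ?_ ?_ (fun m => ?_) fun m => ?_
  · rw [labels_family_pair_one]
    exact haltSet_nonempty
  · rw [labels_family_pair_one, specialClass_singletonStages]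
    exact Set.singleton_nonempty b
  · rw [labels_family_pair_one, specialClass_singletonStages]
    rcases labels_family_cases haltStages (family haltStages m).1 with ⟨t, ht⟩ | ⟨t, ht⟩
    · rw [ht]
      exact hsub fun n hn => Or.inr (Or.inl hn)
    · rw [ht]
      exact hsub le_rfl
  · rw [labels_family_pair_one, specialClass_haltStages]
    rcases labels_family_cases (singletonStages b) (family (singletonStages b) m).1 with
      ⟨t, ht⟩ | ⟨t, ht⟩
    · rw [ht]
      exact hcommon t
    · rw [ht, specialClass_singletonStages]
      exact fun h => hb (h rfl)

/-! ### Computability of the structures -/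

theorem primrec_haltsBy : Primrec₂ haltsBy := by
  have h1 : PrimrecRel fun (j : ℕ) (p : ℕ × ℕ) =>
      (Code.evaln p.1 (Denumerable.ofNat Code p.2) j).isSome = true :=
    Primrec.eq.comp (Primrec.option_isSome.comp <| Code.primrec_evaln.comp <|
      Primrec.pair (Primrec.pair (Primrec.fst.comp Primrec.snd)
        ((Primrec.ofNat Code).comp (Primrec.snd.comp Primrec.snd))) Primrec.fst) (Primrec.const _)
  have hu : Primrec fun p : ℕ × ℕ => p.2.unpair := Primrec.unpair.comp Primrec.snd
  have h2 := h1.forall_mem_list.comp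
    (Primrec.list_range.comp (Primrec.succ.comp (Primrec.snd.comp hu)))
    (Primrec.pair Primrec.fst (Primrec.fst.comp hu))
  exact (h2.decide).of_eq fun p => by simp [haltsBy]

theorem primrec_family {α : Type*} [Primcodable α] {ex : α → ℕ → ℕ → ℕ → Bool}
    (hex : Primrec fun p : α × ℕ × ℕ × ℕ => ex p.1 p.2.1 p.2.2.1 p.2.2.2) :
    Primrec₂ fun a => family (ex a) := by
  have hm : Primrec fun p : α × ℕ => p.2.unpair := Primrec.unpair.comp Primrec.snd
  have hs : Primrec fun p : α × ℕ => p.2.unpair.1 := Primrec.fst.comp hm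
  have hin : Primrec fun p : α × ℕ => p.2.unpair.2.unpair :=
    Primrec.unpair.comp (Primrec.snd.comp hm)
  have hi : Primrec fun p : α × ℕ => p.2.unpair.2.unpair.1.unpair :=
    Primrec.unpair.comp (Primrec.fst.comp hin)
  have hn : Primrec fun p : α × ℕ => p.2.unpair.2.unpair.2 := Primrec.snd.comp hin
  have ht : Primrec fun p : α × ℕ => p.2.unpair.2.unpair.1.unpair.2.unpair.1 :=
    Primrec.fst.comp (Primrec.unpair.comp (Primrec.snd.comp hi))
  have hstage : Primrec fun p : α × ℕ =>
      stage (ex p.1) p.2.unpair.1 p.2.unpair.2.unpair.1 p.2.unpair.2.unpair.2 :=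
    Primrec.cond (Primrec.beq.comp (Primrec.fst.comp hi) (Primrec.const 0))
      (Primrec.or.comp (Primrec.beq.comp hn ht)
        (Primrec.or.comp (primrec_haltsBy.comp hs hn) (primrec_haltsBy.comp hs ht)))
      (hex.comp (Primrec.pair Primrec.fst (Primrec.pair hs (Primrec.pair ht hn))))
  exact Primrec.cond hstage hin (Primrec.const (0, 0))

theorem primrec_family_haltStages : Primrec (family haltStages) :=
  (primrec_family (α := Unit) (ex := fun _ => haltStages)
    (primrec_haltsBy.comp (Primrec.fst.comp Primrec.snd)
      (Primrec.snd.comp (Primrec.snd.comp Primrec.snd)))).comp (Primrec.const ()) Primrec.id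

theorem primrec_family_singletonStages (b : ℕ) : Primrec (family (singletonStages b)) :=
  (primrec_family (α := Unit) (ex := fun _ => singletonStages b)
    (Primrec.beq.comp (Primrec.snd.comp (Primrec.snd.comp Primrec.snd)) (Primrec.const b))).comp
      (Primrec.const ()) Primrec.id

theorem primrec_family_diagStages (b : ℕ) : Primrec₂ fun e => family (diagStages b e) := by
  refine primrec_family ?_
  have he : Primrec fun p : ℕ × ℕ × ℕ × ℕ => p.1 := Primrec.fst
  have hs : Primrec fun p : ℕ × ℕ × ℕ × ℕ => p.2.1 := Primrec.fst.comp Primrec.snd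
  have ht : Primrec fun p : ℕ × ℕ × ℕ × ℕ => p.2.2.1 :=
    Primrec.fst.comp (Primrec.snd.comp Primrec.snd)
  have hn : Primrec fun p : ℕ × ℕ × ℕ × ℕ => p.2.2.2 :=
    Primrec.snd.comp (Primrec.snd.comp Primrec.snd)
  have hpred : ∀ {k : ℕ × ℕ × ℕ × ℕ → ℕ}, Primrec k → Primrec fun p => k p - 1 :=
    fun hk => Primrec.nat_sub.comp hk (Primrec.const 1)
  have hbelow : ∀ {k : ℕ × ℕ × ℕ × ℕ → ℕ}, Primrec k →
      Primrec fun p => haltsBelowBy p.2.1 p.1 (k p) := fun hk =>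
    Primrec.or.comp (Primrec.beq.comp hk (Primrec.const 0))
      (primrec_haltsBy.comp hs (Primrec₂.natPair.comp he (hpred hk)))
  have hu := Primrec.unpair.comp hn
  exact Primrec.cond (Primrec.beq.comp ht (Primrec.const 0))
    (Primrec.or.comp (primrec_haltsBy.comp hs hn)
      (Primrec.and.comp (Primrec.beq.comp (Primrec.fst.comp hu) he) (hbelow (Primrec.snd.comp hu))))
    (Primrec.and.comp (hbelow (hpred ht))
      (Primrec.or.comp (Primrec.beq.comp hn (Primrec.const b))
        (primrec_haltsBy.comp hs (Primrec₂.natPair.comp he (hpred ht)))))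

theorem primrec_templateRel (j : Fin 3) : Primrec₂ (templateRel j) := by
  have h1 : Primrec fun p : (ℕ × ℕ) × (ℕ × ℕ) => p.1.2 := Primrec.snd.comp Primrec.fst
  have h2 : Primrec fun p : (ℕ × ℕ) × (ℕ × ℕ) => p.2.2 := Primrec.snd.comp Primrec.snd
  fin_cases j
  · exact Primrec.beq.comp h1 (Primrec.const 0)
  · exact Primrec.beq.comp h2 (Primrec.succ.comp h1)
  · exact Primrec.beq.comp (Primrec.fst.comp Primrec.fst) (Primrec.fst.comp Primrec.snd)

theorem isComputable_pullback {f : ℕ → ℕ × ℕ} (hf : Primrec f) : IsComputable (pullback f) := by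
  intro j
  have happ : ∀ x : Fin 2, Primrec fun v : Fin 2 → ℕ => f (v x) := fun x =>
    hf.comp (Primrec.fin_app.comp Primrec.id (Primrec.const x))
  exact PrimrecPred.computablePred
    (Primrec.eq.comp ((primrec_templateRel j).comp (happ 0) (happ 1)) (Primrec.const true))

theorem map_tuples_two {σ : Type*} (N : ℕ) (F : (Fin 2 → Fin N) → σ) (G : ℕ → ℕ → σ)
    (hFG : ∀ v, F v = G (v 0) (v 1)) :
    (tuples N 2).map F =
      (List.range N).flatMap fun a => (List.range N).map fun b => G a b := by
  have hone : tuples N 1 = (List.finRange N).map fun b => Fin.cons b Fin.elim0 := by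
    simp [tuples, List.map_eq_flatMap]
  have hrange : List.range N = (List.finRange N).map Fin.val := by simp
  rw [tuples, hone, hrange, List.map_flatMap, List.flatMap_map]
  simp only [List.map_map]
  congr 1
  funext a
  congr 1
  funext b
  simp only [Function.comp_apply, hFG]
  rfl

theorem code_restrict_pullback (f : ℕ → ℕ × ℕ) (n : ℕ) :
    code (restrict (pullback f) n) =
      (n, List.ofFn fun j : Fin 3 => (List.range (n + 1)).flatMap fun a =>
        (List.range (n + 1)).map fun b => templateRel j (f a) (f b)) := by
  refine Prod.ext rfl ?_
  change List.ofFn _ = List.ofFn _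
  refine congrArg List.ofFn (funext fun j => ?_)
  refine map_tuples_two (n + 1) _ (fun a b => templateRel j (f a) (f b)) fun v => ?_
  rw [Bool.eq_iff_iff, @decide_eq_true_iff _ (Classical.propDecidable _)]
  rfl

theorem primrec_code_restrict {F : ℕ → ℕ → ℕ × ℕ} (hF : Primrec₂ F) :
    Primrec₂ fun e n => code (restrict (pullback (F e)) n) := by
  have htable : ∀ j : Fin 3, Primrec fun p : ℕ × ℕ => (List.range (p.2 + 1)).flatMap fun a =>
        (List.range (p.2 + 1)).map fun b => templateRel j (F p.1 a) (F p.1 b) := by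
    intro j
    have hr : Primrec fun p : ℕ × ℕ => List.range (p.2 + 1) :=
      Primrec.list_range.comp (Primrec.succ.comp Primrec.snd)
    refine Primrec.list_flatMap hr (Primrec.list_map (hr.comp Primrec.fst) ?_)
    have he : Primrec fun q : ((ℕ × ℕ) × ℕ) × ℕ => q.1.1.1 :=
      Primrec.fst.comp (Primrec.fst.comp Primrec.fst)
    exact (primrec_templateRel j).comp (hF.comp he (Primrec.snd.comp Primrec.fst))
      (hF.comp he Primrec.snd)
  exact (Primrec.pair Primrec.snd (Primrec.list_ofFn htable)).of_eq fun p =>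
    (code_restrict_pullback (F p.1) p.2).symm

/-! ### Diagonalization against computable learners -/

theorem partrec_search {ψ : ℕ → ℕ →. Hypothesis 2} (hψ : Partrec₂ ψ) :
    Partrec₂ fun (c : Code) (k : ℕ) => Nat.rfind fun n =>
      (ψ (Encodable.encode c) (k + n)).map fun y => !(y == some (0 : Fin 2)) := by
  have hargs : Partrec₂ fun (p : Code × ℕ) (n : ℕ) => ψ (Encodable.encode p.1) (p.2 + n) :=
    Partrec₂.comp hψ (Primrec.encode.comp (Primrec.fst.comp Primrec.fst)).to_comp
      (Primrec.nat_add.comp (Primrec.snd.comp Primrec.fst) Primrec.snd).to_comp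
  have htest : Computable fun y : Hypothesis 2 => !(y == some (0 : Fin 2)) :=
    (Primrec.dom_finite _).to_comp
  exact Partrec.rfind <| Partrec.map hargs (htest.comp Computable.snd).to₂

/-- The recursion theorem yields a program that halts on `k` exactly if the learner, fed with the
program's own diagonal structure, conjectures something else than the first structure at some stage
from `k` on. Whether or not this program is total, the learner then fails on that structure. -/
theorem not_computablyLearnable {b : ℕ}
    (hni : ¬ Iso (pullback (family haltStages)) (pullback (family (singletonStages b)))) :
    ¬ ComputablyLearnable
      ![pullback (family haltStages), pullback (family (singletonStages b))] := by
  rintro ⟨M, ⟨φ, hφ, hMφ⟩, hM⟩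
  set T : ℕ → Str (fun _ : Fin 3 => 2) := fun e => pullback (family (diagStages b e)) with hT
  have hresp : Partrec₂ fun e n => φ (code (restrict (T e) n)) :=
    hφ.comp (primrec_code_restrict (primrec_family_diagStages b)).to_comp
  obtain ⟨c, hc⟩ := Code.fixed_point₂ (partrec_search hresp)
  set e := Encodable.encode c with he
  have hiso : (∀ k, Nat.pair e k ∈ haltSet) ∧ Iso (T e) (pullback (family haltStages)) ∨
      (∃ k, ¬ (c.eval k).Dom) ∧ Iso (T e) (pullback (family (singletonStages b))) := by
    classical
    by_cases htot : ∀ k, Nat.pair e k ∈ haltSet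
    · exact Or.inl ⟨htot, iso_diag_of_total htot⟩
    · push Not at htot
      refine Or.inr ⟨?_, iso_diag_of_not_total (k := Nat.find htot)
        (fun i j hij hj => mem_haltSet.2 fun l hl => mem_haltSet.1 hj l (hl.trans hij))
        (Nat.find_spec htot) fun j hj => not_not.1 (Nat.find_min htot hj)⟩
      by_contra! hdom
      exact Nat.find_spec htot (mem_haltSet.2 fun j _ => hdom j)
  have hmem : T e ∈ learningDomain
      ![pullback (family haltStages), pullback (family (singletonStages b))] :=
    hiso.elim (fun h => ⟨0, h.2⟩) fun h => ⟨1, h.2⟩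
  set y : ℕ → Hypothesis 2 := fun n => M ⟨restrict (T e) n, T e, hmem, n, rfl⟩ with hy
  have hφy : ∀ n, φ (code (restrict (T e) n)) = Part.some (y n) := fun n =>
    Part.eq_some_iff.2 (hMφ ⟨restrict (T e) n, T e, hmem, n, rfl⟩)
  have hdom : ∀ k, (c.eval k).Dom ↔ ∃ n, y (k + n) ≠ some 0 := by
    intro k
    have hck : c.eval k = Nat.rfind fun n => Part.some (!(y (k + n) == some (0 : Fin 2))) := by
      refine (congrFun hc k).trans (congrArg Nat.rfind (funext fun n => ?_))
      exact (congrArg _ (hφy (k + n))).trans (Part.map_some _ _)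
    rw [hck]
    exact Nat.rfind_dom.trans (by simp)
  have hM0 : (∀ᶠ n in atTop, y n = some 0) ↔ Iso (T e) (pullback (family haltStages)) :=
    hM (T e) hmem 0
  rcases hiso with ⟨htot, h0⟩ | ⟨⟨k, hk⟩, h1⟩
  · obtain ⟨k, hk⟩ := eventually_atTop.1 (hM0.2 h0)
    obtain ⟨n, hn⟩ := (hdom k).1 (mem_haltSet.1 (htot k) k le_rfl)
    exact hn (hk _ (Nat.le_add_right k n))
  · have hev : ∀ᶠ n in atTop, y n = some 0 := by
      refine eventually_atTop.2 ⟨k, fun n hn => ?_⟩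
      by_contra hne
      exact hk ((hdom k).2 ⟨n - k, by rwa [Nat.add_sub_cancel' hn]⟩)
    obtain ⟨g0⟩ := hM0.1 hev
    obtain ⟨g1⟩ := h1
    exact hni ⟨@FirstOrder.Language.Equiv.comp _ _ _ (pullback _) (T e) _ (pullback _) g1
      (@FirstOrder.Language.Equiv.symm _ _ _ (T e) (pullback _) g0)⟩

end StructLearning

theorem theorem3 :
    ∃ (k : ℕ) (ar : Fin k → ℕ) (K : Fin 2 → StructLearning.Str ar),
      (∀ i, StructLearning.IsComputable (K i)) ∧
      ¬ StructLearning.Iso (K 0) (K 1) ∧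
      StructLearning.Learnable K ∧
      ¬ StructLearning.ComputablyLearnable K := by
  open StructLearning in
  obtain ⟨b, hb⟩ := exists_notMem_haltSet
  obtain ⟨hlearn, hni⟩ := learnable_halt_singleton hb
  refine ⟨3, fun _ => 2, ![pullback (family haltStages), pullback (family (singletonStages b))],
    fun i => ?_, hni, hlearn, not_computablyLearnable hni⟩
  fin_cases i
  · exact isComputable_pullback primrec_family_haltStages
  · exact isComputable_pullback (primrec_family_singletonStages b)
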